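/- Let $I,J\in\mathbb N$, let $\mathcal X=\mathbb Z_+^J$ with $|x|=x_1+\dots+x_J$, let $\mathcal L\subseteq\mathbb R^I$, and for every $\lambda\in\mathcal L$ let $X^{(\lambda)}=(X^{(\lambda)}_k)_{k\ge 0}$ be a Markov chain on $\mathcal X$ whose transition probabilities depend measurably on $\lambda$. Let $f:\mathcal X\to[0,\infty)$ be such that the increments are bounded: there is $\phi_f>0$ with $|f(X^{(\lambda)}_{k+1})-f(X^{(\lambda)}_k)|\le\phi_f$ almost surely for all $k$, all $\lambda\in\mathcal L$ and all initial states. Suppose that $\mathcal L$ is $f$-stable: there are $\delta,\sigma,\kappa>0$ such that $$\mathbb E\big[f(X^{(\lambda)}_k)-f(X^{(\lambda)}_0)\,\big|\,X^{(\lambda)}_0=x\big]\le-\delta\sigma\qquad\text{for all }\lambda\in\mathcal L,\ \text{all }x\text{ with }|x|\ge\kappa\text{ and all integers }k\ge\sigma.$$ Fix $\eta,c,d>0$, put $\tau(x)=c f(x)+d$, and let $N(x)\in\mathbb Z_+$ be a rounding of $\tau(x)$, $|N(x)-\tau(x)|<1$. Write $[z]_-=\min\{0,z\}$. Let $S_k=(Y_k,\Lambda_k)_{k\ge0}$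 be a Markov chain on $\mathcal X\times\mathcal L$, with arbitrary initial law, produced by one of the following two algorithms; one step from $(x,\lambda)$ is described. (a) Global search, where $\mathcal L$ is measurable with $0<|\mathcal L|<\infty$ ($|\mathcal L|$ being its Lebesgue measure): sample $\gamma$ uniformly from $\mathcal L$, then $y=X^{(\gamma)}_{N(x)}$ given $X^{(\gamma)}_0=x$; move to $(y,\gamma)$ with probability $e^{\eta[f(y)-f(x)]_-}$ and stay at $(x,\lambda)$ otherwise. (b) Local search, where $\mathcal L$ is finite and every $\lambda\in\mathcal L$ has a neighbourhood $\mathcal B_\lambda\subseteq\mathcal L$ with $\lambda\in\mathcal B_\lambda$: sample $\gamma$ uniformly from $\mathcal B_\lambda$, then, independently, $x'=X^{(\lambda)}_{N(x)}$ given $X^{(\lambda)}_0=x$ and $y=X^{(\gamma)}_{N(x)}$ given $X^{(\gamma)}_0=x$; move to $(y,\gamma)$ with probability $e^{\eta[f(y)-f(x')]_-}$ and to $(x',\lambda)$ otherwise. Let $T_k=\sum_{i=0}^{k-1}\tau(Y_i)$. Then, in both cases, almost surely, $$\lim_{k\to\infty}\frac{f(Y_k)}{T_k}=0 .$$ -/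

import Mathlib

open MeasureTheory ProbabilityTheory Filter
open scoped ENNReal Topology

noncomputable section

namespace StabilitySearch

/-- The state space `ℤ₊ᴶ`. -/
abbrev State (J : ℕ) : Type := Fin J → ℕ

/-- The size `|x| = x₁ + ⋯ + x_J` of a state. -/
def size {J : ℕ} (x : State J) : ℕ := ∑ j, x j

section Chains

variable {J : ℕ} {Θ : Type*} [MeasurableSpace Θ]

/-- A family of Markov chains on `State J`, indexed measurably by `θ : Θ`, is given by the one-step
transition probabilities `P (θ, x)`. `nStep P θ n x` is the law of `X_n^(θ)` given `X_0^(θ) = x`. -/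
def nStep (P : Kernel (Θ × State J) (State J)) (θ : Θ) : ℕ → State J → Measure (State J)
  | 0, x => Measure.dirac x
  | n + 1, x => (nStep P θ n x).bind fun z => P (θ, z)

/-- All the processes `f(X^(θ))` have increments bounded by one common constant. -/
def BoundedIncrements (P : Kernel (Θ × State J) (State J)) (f : State J → ℝ) : Prop :=
  ∃ φ : ℝ, 0 < φ ∧ ∀ (θ : Θ) (x : State J), ∀ᵐ y ∂(P (θ, x)), |f y - f x| ≤ φ

/-- `f`-stability of the whole parameter set: a uniform negative drift of `f(X^(θ))`. -/
def IsFStable (P : Kernel (Θ × State J) (State J)) (f : State J → ℝ) : Prop :=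
  ∃ δ σ κ : ℝ, 0 < δ ∧ 0 < σ ∧ 0 < κ ∧
    ∀ (θ : Θ) (x : State J) (k : ℕ), κ ≤ (size x : ℝ) → σ ≤ (k : ℝ) →
      ∫ y, (f y - f x) ∂(nStep P θ k x) ≤ -(δ * σ)

/-- The Metropolis rule: move from `s` to the proposal `s'` with probability
`exp (η * min 0 (f(s') - f(s)))`, stay at `s` otherwise. -/
def metropolis (η : ℝ) (f : State J → ℝ) (s s' : State J × Θ) : Measure (State J × Θ) :=
  ENNReal.ofReal (Real.exp (η * min 0 (f s'.1 - f s.1))) • Measure.dirac s' +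
    ENNReal.ofReal (1 - Real.exp (η * min 0 (f s'.1 - f s.1))) • Measure.dirac s

/-- One iteration of the global search from `s = (x, λ)`: sample `γ` from the law `U`, sample
`y = X^(γ)_{N(x)}` given `X^(γ)_0 = x`, and compare `(y, γ)` with `(x, λ)`. -/
def globalStep (P : Kernel (Θ × State J) (State J)) (f : State J → ℝ) (η : ℝ)
    (N : State J → ℕ) (U : Measure Θ) (s : State J × Θ) : Measure (State J × Θ) :=
  U.bind fun γ => (nStep P γ (N s.1) s.1).bind fun y => metropolis η f s (y, γ)

/-- One iteration of the local search from `s = (x, λ)`: sample `γ` uniformly from the (finite)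
neighbourhood `B λ`, sample independently `x' = X^(λ)_{N(x)}` and `y = X^(γ)_{N(x)}`, both
started from `x`, and compare `(y, γ)` with `(x', λ)`. -/
def localStep (P : Kernel (Θ × State J) (State J)) (f : State J → ℝ) (η : ℝ)
    (N : State J → ℕ) (B : Θ → Set Θ) (s : State J × Θ) : Measure (State J × Θ) :=
  (uniformOn (B s.2)).bind fun γ => (nStep P s.2 (N s.1) s.1).bind fun x' =>
    (nStep P γ (N s.1) s.1).bind fun y => metropolis η f (x', s.2) (y, γ)

end Chains

/-- The uniform distribution on a set `L ⊆ ℝᴵ` of finite positive Lebesgue measure, as a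
measure on the subtype `L`. -/
def uniformParam {I : ℕ} (L : Set (Fin I → ℝ)) : Measure L :=
  (ProbabilityTheory.cond (volume : Measure (Fin I → ℝ)) L).comap Subtype.val

/-- `S` is a Markov chain with respect to the filtration `ℱ` with transition probabilities `Q`:
the conditional law of `S (k + 1)` given `ℱ k` is `Q (S k)`. The law of `S 0` is arbitrary. -/
structure IsMarkovChain {Ω E : Type*} [mΩ : MeasurableSpace Ω] [MeasurableSpace E]
    (μ : Measure Ω) (ℱ : Filtration ℕ mΩ) (Q : E → Measure E) (S : ℕ → Ω → E) : Prop where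
  adapted : ∀ k, Measurable[ℱ k] (S k)
  transition : ∀ (k : ℕ) (F : Set Ω), MeasurableSet[ℱ k] F → ∀ A : Set E, MeasurableSet A →
    μ (F ∩ S (k + 1) ⁻¹' A) = ∫⁻ ω in F, Q (S k ω) A ∂μ

/-- The total simulated time `T_k = ∑_{i<k} τ(Y_i)` along a path `y`. -/
def totalTime {J : ℕ} (τ : State J → ℝ) (y : ℕ → State J) (k : ℕ) : ℝ :=
  ∑ i ∈ Finset.range k, τ (y i)

end StabilitySearch

end

/-!
Let `V = e^(t f)` with `t` small. Over a block of `⌈σ⌉` steps the bounded increments of `f` and its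
negative drift outside a finite set give, by Hoeffding's lemma, a contraction of `V` up to an
additive constant. Iterating this over the roughly `c f(x)` steps of a run started at `x` and
applying Markov's inequality shows that the run ends above the level `f(x)` with probability at most
`C e^(-β f(x))`, uniformly in the parameter. A search step can raise `f` only through the endpoint
of a run, so by the Borel–Cantelli lemma `f(Y_k)` almost surely rises only from levels below
`(2/β) log k` once `k` is large. As `f(Y_{k+1})` is at most an affine function of `f(Y_k)`, it
follows that `f(Y_k) = O(log k)`, whereas `T_k ≥ d k`.
-/

namespace StabilitySearch

/-- The exponential `e^r` as an extended nonnegative real, the form in which exponential moments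
enter Lebesgue integrals. It agrees with `EReal.exp` but takes a real argument, so that exponents
need no casts. -/
noncomputable def ennexp (r : ℝ) : ℝ≥0∞ := ENNReal.ofReal (Real.exp r)

theorem ennexp_zero : ennexp 0 = 1 := by simp [ennexp]

theorem ennexp_add (r s : ℝ) : ennexp (r + s) = ennexp r * ennexp s := by
  rw [ennexp, Real.exp_add, ENNReal.ofReal_mul (Real.exp_pos r).le, ennexp, ennexp]

theorem ennexp_nat_mul (n : ℕ) (r : ℝ) : ennexp (n * r) = ennexp r ^ n := by
  rw [ennexp, Real.exp_nat_mul, ENNReal.ofReal_pow (Real.exp_pos r).le, ennexp]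

theorem ennexp_mono : Monotone ennexp := fun _ _ h =>
  ENNReal.ofReal_le_ofReal (Real.exp_le_exp.2 h)

theorem ennexp_lt_one {r : ℝ} (hr : r < 0) : ennexp r < 1 :=
  ENNReal.ofReal_lt_one.2 (Real.exp_lt_one_iff.2 hr)

theorem ennexp_ne_top (r : ℝ) : ennexp r ≠ ∞ := ENNReal.ofReal_ne_top

@[fun_prop]
theorem measurable_ennexp : Measurable ennexp :=
  ENNReal.measurable_ofReal.comp Real.measurable_exp

section ExponentialMoment

variable {α : Type*} [MeasurableSpace α] {ν : Measure α}

theorem measure_lt_le_ennexp_mul_lintegral {f : α → ℝ} (hf : Measurable f) {t : ℝ} (ht : 0 ≤ t)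
    (r : ℝ) : ν {y | r < f y} ≤ ennexp (-(t * r)) * ∫⁻ y, ennexp (t * f y) ∂ν :=
  calc ν {y | r < f y}
      ≤ ν {y | 1 ≤ ennexp (-(t * r)) * ennexp (t * f y)} := by
        refine measure_mono fun y (hy : r < f y) => ?_
        rw [Set.mem_ofPred_eq, ← ennexp_zero, ← ennexp_add]
        exact ennexp_mono (by linarith [mul_le_mul_of_nonneg_left hy.le ht])
    _ ≤ ∫⁻ y, ennexp (-(t * r)) * ennexp (t * f y) ∂ν := by
        simpa only [one_mul] using
          mul_meas_ge_le_lintegral (μ := ν) (by fun_prop : Measurable fun y =>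
            ennexp (-(t * r)) * ennexp (t * f y)) 1
    _ = ennexp (-(t * r)) * ∫⁻ y, ennexp (t * f y) ∂ν := lintegral_const_mul _ (by fun_prop)

variable [IsProbabilityMeasure ν] {Z : α → ℝ} {M t : ℝ}

theorem mgf_le_exp_of_abs_le (hZ : AEMeasurable Z ν) (hM : ∀ᵐ y ∂ν, |Z y| ≤ M) :
    mgf Z ν t ≤ Real.exp (t * ∫ y, Z y ∂ν + t ^ 2 * M ^ 2 / 2) := by
  have hoeffding := (hasSubgaussianMGF_of_mem_Icc hZ
    (hM.mono fun _ hy => Set.mem_Icc.2 (abs_le.1 hy))).mgf_le t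
  have hvar : (((‖M - -M‖₊ / 2) ^ 2 : NNReal) : ℝ) = M ^ 2 := by
    simp [← two_mul, sq_abs]
  rw [hvar] at hoeffding
  simp only [sub_eq_add_neg, mgf_add_const] at hoeffding
  rw [mul_neg, Real.exp_neg, ← div_eq_mul_inv, div_le_iff₀ (Real.exp_pos _),
    ← Real.exp_add] at hoeffding
  exact hoeffding.trans_eq (by ring_nf)

theorem lintegral_ennexp_le_of_integral_le (hZ : AEMeasurable Z ν) (hM : ∀ᵐ y ∂ν, |Z y| ≤ M)
    {q : ℝ} (hq : ∫ y, Z y ∂ν ≤ -q) (ht : 0 ≤ t) (htM : t * M ^ 2 ≤ q) :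
    ∫⁻ y, ennexp (t * Z y) ∂ν ≤ ennexp (-(t * q / 2)) := by
  have hint : Integrable (fun y => Real.exp (t * Z y)) ν :=
    integrable_exp_mul_of_mem_Icc hZ (hM.mono fun _ hy => Set.mem_Icc.2 (abs_le.1 hy))
  calc ∫⁻ y, ennexp (t * Z y) ∂ν
      = ENNReal.ofReal (mgf Z ν t) :=
        (ofReal_integral_eq_lintegral_ofReal hint (ae_of_all _ fun _ => (Real.exp_pos _).le)).symm
    _ ≤ ennexp (t * ∫ y, Z y ∂ν + t ^ 2 * M ^ 2 / 2) :=
        ENNReal.ofReal_le_ofReal (mgf_le_exp_of_abs_le hZ hM)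
    _ ≤ ennexp (-(t * q / 2)) := ennexp_mono (by
        linarith [mul_le_mul_of_nonneg_left hq ht, mul_le_mul_of_nonneg_left htM ht])

end ExponentialMoment

section GeometricDrift

variable {X : Type*} [MeasurableSpace X] {κ : Kernel X X}

theorem pow_zero_apply (κ : Kernel X X) (x : X) : (κ ^ 0) x = Measure.dirac x := Kernel.id_apply x

theorem lintegral_pow_add (κ : Kernel X X) (m n : ℕ) (x : X) {g : X → ℝ≥0∞} (hg : Measurable g) :
    ∫⁻ y, g y ∂(κ ^ (m + n)) x = ∫⁻ z, ∫⁻ y, g y ∂(κ ^ m) z ∂(κ ^ n) x := by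
  rw [Kernel.pow_add, Kernel.lintegral_comp _ _ _ hg]

theorem ae_pow_abs_sub_le {f : X → ℝ} (hf : Measurable f) {φ : ℝ}
    (hφ : ∀ x, ∀ᵐ y ∂κ x, |f y - f x| ≤ φ) (n : ℕ) (x : X) :
    ∀ᵐ y ∂(κ ^ n) x, |f y - f x| ≤ n * φ := by
  have hmeas (r : ℝ) : MeasurableSet {y | |f y - f x| ≤ r} :=
    measurableSet_le (by fun_prop) measurable_const
  induction n with
  | zero => rw [pow_zero_apply, ae_dirac_iff (hmeas _)]; simp
  | succ n ih =>
    rw [pow_succ']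
    refine Kernel.ae_comp_of_ae_ae (hmeas _) ?_
    filter_upwards [ih] with z hz
    filter_upwards [hφ z] with y hy
    push_cast
    linarith [abs_sub_le (f y) (f z) (f x)]

variable [IsMarkovKernel κ]

instance isMarkovKernel_pow (n : ℕ) : IsMarkovKernel (κ ^ n) := by
  induction n with
  | zero => exact inferInstanceAs (IsMarkovKernel Kernel.id)
  | succ n ih => exact pow_succ κ n ▸ inferInstanceAs (IsMarkovKernel ((κ ^ n) ∘ₖ κ))

theorem lintegral_pow_le_of_drift {V : X → ℝ≥0∞} (hV : Measurable V) {a b : ℝ≥0∞} (ha : a < 1)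
    (hdrift : ∀ x, ∫⁻ y, V y ∂κ x ≤ a * V x + b) (n : ℕ) (x : X) :
    ∫⁻ y, V y ∂(κ ^ n) x ≤ a ^ n * V x + b / (1 - a) := by
  have hfix : a * (b / (1 - a)) + b = b / (1 - a) := by
    have hb : (1 - a) * (b / (1 - a)) = b :=
      ENNReal.mul_div_cancel (tsub_pos_of_lt ha).ne' (ENNReal.sub_ne_top ENNReal.one_ne_top)
    nth_rw 2 [← hb]
    rw [← add_mul, add_tsub_cancel_of_le ha.le, one_mul]
  induction n with
  | zero =>
    rw [pow_zero_apply, lintegral_dirac' x hV, pow_zero, one_mul]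
    exact le_self_add
  | succ n ih =>
    calc ∫⁻ y, V y ∂(κ ^ (n + 1)) x
        = ∫⁻ z, ∫⁻ y, V y ∂κ z ∂(κ ^ n) x := by
          rw [add_comm, lintegral_pow_add κ 1 n x hV, pow_one]
      _ ≤ ∫⁻ z, (a * V z + b) ∂(κ ^ n) x := lintegral_mono hdrift
      _ = a * ∫⁻ z, V z ∂(κ ^ n) x + b := by
          rw [lintegral_add_right _ measurable_const, lintegral_const_mul _ hV]
          simp
      _ ≤ a * (a ^ n * V x + b / (1 - a)) + b := by gcongr
      _ = a ^ (n + 1) * V x + b / (1 - a) := by rw [mul_add, add_assoc, hfix, pow_succ']; ring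

variable {f : X → ℝ} {φ t : ℝ}

theorem lintegral_ennexp_le_of_drift (hf : Measurable f) (hφ : ∀ x, ∀ᵐ y ∂κ x, |f y - f x| ≤ φ)
    {C : Set X} {F q : ℝ} (hF : ∀ x ∈ C, f x ≤ F) (hq : ∀ x ∉ C, ∫ y, (f y - f x) ∂κ x ≤ -q)
    (ht : 0 ≤ t) (htφ : t * φ ^ 2 ≤ q) (x : X) :
    ∫⁻ y, ennexp (t * f y) ∂κ x ≤
      ennexp (-(t * q / 2)) * ennexp (t * f x) + ennexp (t * (F + φ)) := by
  by_cases hx : x ∈ C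
  · refine le_add_left (lintegral_le_const ?_)
    filter_upwards [hφ x] with y hy
    exact ennexp_mono (mul_le_mul_of_nonneg_left (by linarith [hF x hx, (abs_le.1 hy).2]) ht)
  · refine le_add_right ?_
    calc ∫⁻ y, ennexp (t * f y) ∂κ x
        = ∫⁻ y, ennexp (t * (f y - f x)) * ennexp (t * f x) ∂κ x := by
          simp only [← ennexp_add, ← mul_add, sub_add_cancel]
      _ = (∫⁻ y, ennexp (t * (f y - f x)) ∂κ x) * ennexp (t * f x) :=
          lintegral_mul_const _ (by fun_prop)
      _ ≤ ennexp (-(t * q / 2)) * ennexp (t * f x) := by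
          gcongr
          exact lintegral_ennexp_le_of_integral_le (by fun_prop) (hφ x) (hq x hx) ht htφ

theorem lintegral_ennexp_pow_le (hf : Measurable f) (hφ₀ : 0 ≤ φ)
    (hφ : ∀ x, ∀ᵐ y ∂κ x, |f y - f x| ≤ φ) {m : ℕ} (hm : 0 < m) {α : ℝ} (hα : 0 < α) {b : ℝ≥0∞}
    (ht : 0 ≤ t) (hdrift : ∀ x, ∫⁻ y, ennexp (t * f y) ∂(κ ^ m) x ≤
      ennexp (-α) * ennexp (t * f x) + b) (n : ℕ) (x : X) :
    ∫⁻ y, ennexp (t * f y) ∂(κ ^ n) x ≤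
      ennexp (α + t * (m * φ)) * ennexp (-(α / m * n)) * ennexp (t * f x) +
        b / (1 - ennexp (-α)) := by
  have hblocks (z : X) := lintegral_pow_le_of_drift (by fun_prop : Measurable fun y =>
    ennexp (t * f y)) (ennexp_lt_one (neg_neg_of_pos hα)) hdrift (n / m) z
  have hremainder : ∫⁻ z, ennexp (t * f z) ∂(κ ^ (n % m)) x ≤ ennexp (t * (m * φ) + t * f x) := by
    refine lintegral_le_const ?_
    have hr : ((n % m : ℕ) : ℝ) * φ ≤ m * φ := by gcongr; exact (Nat.mod_lt n hm).le
    filter_upwards [ae_pow_abs_sub_le hf hφ (n % m) x] with z hz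
    rw [← mul_add]
    exact ennexp_mono (mul_le_mul_of_nonneg_left (by linarith [(abs_le.1 hz).2]) ht)
  have hcount : α / m * n ≤ α * (n / m : ℕ) + α := by
    rw [div_mul_eq_mul_div, mul_div_assoc, ← mul_add_one]
    gcongr
    rw [← Nat.floor_div_eq_div (K := ℝ)]
    exact (Nat.lt_floor_add_one _).le
  calc ∫⁻ y, ennexp (t * f y) ∂(κ ^ n) x
      = ∫⁻ z, ∫⁻ y, ennexp (t * f y) ∂((κ ^ m) ^ (n / m)) z ∂(κ ^ (n % m)) x := by
        rw [← pow_mul, ← lintegral_pow_add κ _ _ x (by fun_prop), Nat.div_add_mod]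
    _ ≤ ∫⁻ z, (ennexp (-α) ^ (n / m) * ennexp (t * f z) + b / (1 - ennexp (-α)))
          ∂(κ ^ (n % m)) x := lintegral_mono hblocks
    _ = ennexp (-α) ^ (n / m) * ∫⁻ z, ennexp (t * f z) ∂(κ ^ (n % m)) x +
          b / (1 - ennexp (-α)) := by
        rw [lintegral_add_right _ measurable_const, lintegral_const_mul _ (by fun_prop)]
        simp
    _ ≤ ennexp (-α) ^ (n / m) * ennexp (t * (m * φ) + t * f x) + b / (1 - ennexp (-α)) := by
        gcongr
    _ ≤ _ := by
        simp only [← ennexp_nat_mul, ← ennexp_add]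
        gcongr
        exact ennexp_mono (by linarith)

theorem measure_pow_lt_le (hf : Measurable f) (hφ₀ : 0 ≤ φ)
    (hφ : ∀ x, ∀ᵐ y ∂κ x, |f y - f x| ≤ φ) {m : ℕ} (hm : 0 < m) {α : ℝ} (hα : 0 < α) {b : ℝ≥0∞}
    (ht : 0 ≤ t) (hdrift : ∀ x, ∫⁻ y, ennexp (t * f y) ∂(κ ^ m) x ≤
      ennexp (-α) * ennexp (t * f x) + b) (n : ℕ) (x : X) :
    (κ ^ n) x {y | f x < f y} ≤ ennexp (α + t * (m * φ)) * ennexp (-(α / m * n)) +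
      b / (1 - ennexp (-α)) * ennexp (-(t * f x)) := by
  refine (measure_lt_le_ennexp_mul_lintegral hf ht (f x)).trans ?_
  have hcancel : ennexp (-(t * f x)) * ennexp (t * f x) = 1 := by
    rw [← ennexp_add, neg_add_cancel, ennexp_zero]
  calc ennexp (-(t * f x)) * ∫⁻ y, ennexp (t * f y) ∂(κ ^ n) x
      ≤ ennexp (-(t * f x)) * (ennexp (α + t * (m * φ)) * ennexp (-(α / m * n)) *
          ennexp (t * f x) + b / (1 - ennexp (-α))) := by
        gcongr
        exact lintegral_ennexp_pow_le hf hφ₀ hφ hm hα ht hdrift n x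
    _ = ennexp (α + t * (m * φ)) * ennexp (-(α / m * n)) *
          (ennexp (-(t * f x)) * ennexp (t * f x)) +
          b / (1 - ennexp (-α)) * ennexp (-(t * f x)) := by ring
    _ = _ := by rw [hcancel, mul_one]

end GeometricDrift

section NStep

variable {J : ℕ} {Θ : Type*} [MeasurableSpace Θ] {P : Kernel (Θ × State J) (State J)}
  {f : State J → ℝ}

theorem nStep_eq_pow (P : Kernel (Θ × State J) (State J)) (θ : Θ) (n : ℕ) (x : State J) :
    nStep P θ n x = (P.sectR θ ^ n) x := by
  induction n with
  | zero => rw [pow_zero_apply, nStep]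
  | succ n ih => rw [nStep, ih, add_comm n 1, Kernel.pow_add, pow_one, Kernel.comp_apply]; rfl

instance isProbabilityMeasure_nStep [IsMarkovKernel P] (θ : Θ) (n : ℕ) (x : State J) :
    IsProbabilityMeasure (nStep P θ n x) :=
  nStep_eq_pow P θ n x ▸ inferInstance

theorem ae_nStep_abs_sub_le {φ : ℝ} (hφ : ∀ θ x, ∀ᵐ y ∂(P (θ, x)), |f y - f x| ≤ φ) (θ : Θ)
    (n : ℕ) (x : State J) : ∀ᵐ y ∂(nStep P θ n x), |f y - f x| ≤ n * φ := by
  rw [nStep_eq_pow]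
  exact ae_pow_abs_sub_le .of_discrete (hφ θ) n x

theorem finite_setOf_size_lt (κ : ℝ) : {x : State J | (size x : ℝ) < κ}.Finite := by
  refine (Set.finite_Iic fun _ : Fin J => ⌈κ⌉₊).subset fun x hx j => ?_
  calc x j ≤ size x := Finset.single_le_sum (fun _ _ => Nat.zero_le _) (Finset.mem_univ j)
    _ ≤ ⌈κ⌉₊ := by exact_mod_cast (Set.mem_ofPred_eq ▸ hx).le.trans (Nat.le_ceil κ)

theorem exists_ennexp_drift [IsMarkovKernel P] {φ : ℝ}
    (hφ : ∀ θ x, ∀ᵐ y ∂(P (θ, x)), |f y - f x| ≤ φ) (hstable : IsFStable P f) :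
    ∃ (m : ℕ) (t α F : ℝ), 0 < m ∧ 0 < t ∧ 0 < α ∧ ∀ θ x,
      ∫⁻ y, ennexp (t * f y) ∂(P.sectR θ ^ m) x ≤
        ennexp (-α) * ennexp (t * f x) + ennexp F := by
  obtain ⟨δ, σ, κ, hδ, hσ, -, hdrift⟩ := hstable
  obtain ⟨F, hF⟩ := ((finite_setOf_size_lt (J := J) κ).image f).bddAbove
  set m := ⌈σ⌉₊
  set t := δ * σ / ((m * φ) ^ 2 + 1)
  have ht : 0 < t := by positivity
  have htφ : t * (m * φ) ^ 2 ≤ δ * σ := by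
    rw [div_mul_eq_mul_div, div_le_iff₀ (by positivity)]
    gcongr
    linarith
  refine ⟨m, t, t * (δ * σ) / 2, t * (F + m * φ), Nat.ceil_pos.2 hσ, ht, by positivity,
    fun θ => lintegral_ennexp_le_of_drift .of_discrete (ae_pow_abs_sub_le .of_discrete (hφ θ) m)
      (fun x hx => hF ⟨x, hx, rfl⟩) (fun x hx => ?_) ht.le htφ⟩
  rw [← nStep_eq_pow]
  exact hdrift θ x m (not_lt.1 hx) (Nat.le_ceil σ)

theorem exists_nStep_lt_le_ennexp [IsMarkovKernel P] (hf : ∀ x, 0 ≤ f x)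
    (hinc : BoundedIncrements P f) (hstable : IsFStable P f) {c r : ℝ} (hc : 0 < c)
    {N : State J → ℕ} (hN : ∀ x, c * f x - r ≤ N x) :
    ∃ β > 0, ∃ C ≠ ∞, ∀ θ x,
      nStep P θ (N x) x {y | f x < f y} ≤ C * ennexp (-(β * f x)) := by
  obtain ⟨φ, hφ₀, hφ⟩ := hinc
  obtain ⟨m, t, α, F, hm, ht, hα, hdrift⟩ := exists_ennexp_drift hφ hstable
  set A := ennexp (α + t * (m * φ))
  set B := ennexp F / (1 - ennexp (-α))
  have hB : B ≠ ∞ := ENNReal.div_ne_top (ennexp_ne_top F)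
    (tsub_pos_of_lt (ennexp_lt_one (neg_neg_of_pos hα))).ne'
  have hγ : 0 < α / m := by positivity
  have hAB : A * ennexp (α / m * r) + B ≠ ∞ :=
    ENNReal.add_ne_top.2 ⟨ENNReal.mul_ne_top (ennexp_ne_top _) (ennexp_ne_top _), hB⟩
  refine ⟨min (α / m * c) t, by positivity, A * ennexp (α / m * r) + B, hAB, fun θ x => ?_⟩
  have hdecay : ennexp (-(α / m * N x)) ≤
      ennexp (α / m * r) * ennexp (-(min (α / m * c) t * f x)) := by
    rw [← ennexp_add]
    refine ennexp_mono ?_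
    have h₁ := mul_le_mul_of_nonneg_left (hN x) hγ.le
    have h₂ := mul_le_mul_of_nonneg_right (min_le_left (α / m * c) t) (hf x)
    linarith
  have hmin : ennexp (-(t * f x)) ≤ ennexp (-(min (α / m * c) t * f x)) :=
    ennexp_mono (neg_le_neg (mul_le_mul_of_nonneg_right (min_le_right _ _) (hf x)))
  calc nStep P θ (N x) x {y | f x < f y}
      ≤ A * ennexp (-(α / m * N x)) + B * ennexp (-(t * f x)) := by
        rw [nStep_eq_pow]
        exact measure_pow_lt_le .of_discrete hφ₀.le (hφ θ) hm hα ht.le (hdrift θ) (N x) x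
    _ ≤ A * (ennexp (α / m * r) * ennexp (-(min (α / m * c) t * f x))) +
          B * ennexp (-(min (α / m * c) t * f x)) := by gcongr
    _ = _ := by ring

end NStep

section Search

variable {J : ℕ} {Θ : Type*} [MeasurableSpace Θ] {P : Kernel (Θ × State J) (State J)}
  {f : State J → ℝ} {η : ℝ} {N : State J → ℕ}

/-- A search step `Q` is run-dominated if, from `(x, λ)` with `x ∉ D`, it moves the state into `D`
with at most twice the largest probability that a run of length `N x` from `x` ends in `D`. The
factor `2` accommodates the local search, which performs two runs. -/
def RunDominated (P : Kernel (Θ × State J) (State J)) (N : State J → ℕ)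
    (Q : State J × Θ → Measure (State J × Θ)) : Prop :=
  ∀ (s : State J × Θ) (D : Set (State J)), s.1 ∉ D →
    Q s (Prod.fst ⁻¹' D) ≤ 2 * ⨆ θ, nStep P θ (N s.1) s.1 D

theorem RunDominated.apply_le {Q : State J × Θ → Measure (State J × Θ)}
    (hQ : RunDominated P N Q) {s : State J × Θ} {D : Set (State J)} (hs : s.1 ∉ D) {b : ℝ≥0∞}
    (hb : ∀ θ, nStep P θ (N s.1) s.1 D ≤ b) : Q s (Prod.fst ⁻¹' D) ≤ 2 * b :=
  (hQ s D hs).trans (mul_le_mul_right (iSup_le hb) 2)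

theorem RunDominated.preimage_lt_le {Q : State J × Θ → Measure (State J × Θ)}
    (hQ : RunDominated P N Q) {C : ℝ≥0∞} {β : ℝ}
    (hrun : ∀ θ x, nStep P θ (N x) x {y | f x < f y} ≤ C * ennexp (-(β * f x)))
    (s : State J × Θ) :
    Q s {s' | f s.1 < f s'.1} ≤ 2 * C * ennexp (-(β * f s.1)) := by
  rw [mul_assoc]
  exact hQ.apply_le (lt_irrefl (f s.1)) fun θ => hrun θ s.1

theorem RunDominated.preimage_affine_lt_eq_zero {Q : State J × Θ → Measure (State J × Θ)}
    (hQ : RunDominated P N Q) (hf : ∀ x, 0 ≤ f x) {φ : ℝ} (hφ₀ : 0 ≤ φ)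
    (hφ : ∀ θ x, ∀ᵐ y ∂(P (θ, x)), |f y - f x| ≤ φ) {c r : ℝ} (hc : 0 ≤ c) (hr : 0 ≤ r)
    (hN : ∀ x, N x ≤ c * f x + r) (s : State J × Θ) :
    Q s {s' | (1 + c * φ) * f s.1 + r * φ < f s'.1} = 0 := by
  refine nonpos_iff_eq_zero.1 ((hQ.apply_le (D := {y | (1 + c * φ) * f s.1 + r * φ < f y})
    ?_ fun θ => le_of_eq ?_).trans_eq (mul_zero 2))
  · have hcφ : 0 ≤ c * φ * f s.1 := mul_nonneg (mul_nonneg hc hφ₀) (hf s.1)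
    have hrφ : 0 ≤ r * φ := mul_nonneg hr hφ₀
    exact fun (hlt : _ < f s.1) => by linarith
  · refine measure_mono_null (fun y (hy : _ < f y) => ?_)
      (ae_iff.1 (ae_nStep_abs_sub_le hφ θ (N s.1) s.1))
    have hlength := mul_le_mul_of_nonneg_right (hN s.1) hφ₀
    exact not_le.2 (by linarith [le_abs_self (f y - f s.1)])

theorem measurableSet_preimage_fst (D : Set (State J)) :
    MeasurableSet (Prod.fst ⁻¹' D : Set (State J × Θ)) :=
  measurable_fst .of_discrete

theorem metropolis_preimage_fst_le (hη : 0 ≤ η) (s s' : State J × Θ) (D : Set (State J)) :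
    metropolis η f s s' (Prod.fst ⁻¹' D) ≤ D.indicator 1 s'.1 + D.indicator 1 s.1 := by
  have hexp : Real.exp (η * min 0 (f s'.1 - f s.1)) ≤ 1 :=
    Real.exp_le_one_iff.2 (mul_nonpos_of_nonneg_of_nonpos hη (min_le_left _ _))
  have hdirac (r : State J × Θ) :
      Measure.dirac r (Prod.fst ⁻¹' D) = D.indicator (1 : State J → ℝ≥0∞) r.1 :=
    Measure.dirac_apply' _ (measurableSet_preimage_fst D)
  rw [metropolis, Measure.add_apply, Measure.smul_apply, Measure.smul_apply, smul_eq_mul,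
    smul_eq_mul, hdirac, hdirac]
  exact add_le_add
    (mul_le_of_le_one_left' (ENNReal.ofReal_le_one.2 hexp))
    (mul_le_of_le_one_left' (ENNReal.ofReal_le_one.2 (sub_le_self _ (Real.exp_pos _).le)))

theorem bind_metropolis_preimage_fst_le (hη : 0 ≤ η) (ν : Measure (State J))
    [IsProbabilityMeasure ν] (s : State J × Θ) (γ : Θ) (D : Set (State J)) :
    (ν.bind fun y => metropolis η f s (y, γ)) (Prod.fst ⁻¹' D) ≤ ν D + D.indicator 1 s.1 :=
  calc (ν.bind fun y => metropolis η f s (y, γ)) (Prod.fst ⁻¹' D)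
      ≤ ∫⁻ y, metropolis η f s (y, γ) (Prod.fst ⁻¹' D) ∂ν :=
        Measure.bind_apply_le _ (measurableSet_preimage_fst D)
    _ ≤ ∫⁻ y, (D.indicator 1 y + D.indicator 1 s.1) ∂ν :=
        lintegral_mono fun y => metropolis_preimage_fst_le hη s (y, γ) D
    _ = ν D + D.indicator 1 s.1 := by
        rw [lintegral_add_right _ measurable_const, lintegral_indicator_one .of_discrete,
          lintegral_const, measure_univ, mul_one]

variable [IsMarkovKernel P]

theorem runDominated_globalStep (hη : 0 ≤ η) (U : Measure Θ) [IsProbabilityMeasure U] :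
    RunDominated P N (globalStep P f η N U) := fun s D hs =>
  calc globalStep P f η N U s (Prod.fst ⁻¹' D)
      ≤ ∫⁻ γ, ((nStep P γ (N s.1) s.1).bind fun y => metropolis η f s (y, γ))
          (Prod.fst ⁻¹' D) ∂U :=
        Measure.bind_apply_le _ (measurableSet_preimage_fst D)
    _ ≤ ⨆ γ, nStep P γ (N s.1) s.1 D := lintegral_le_const (ae_of_all _ fun γ => by
        refine (bind_metropolis_preimage_fst_le hη _ s γ D).trans ?_
        rw [Set.indicator_of_notMem hs, add_zero]
        exact le_iSup (fun γ => nStep P γ (N s.1) s.1 D) γ)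
    _ ≤ 2 * ⨆ γ, nStep P γ (N s.1) s.1 D := le_mul_of_one_le_left zero_le one_le_two

theorem runDominated_localStep (hη : 0 ≤ η) (B : Θ → Set Θ)
    [∀ l, IsProbabilityMeasure (uniformOn (B l))] :
    RunDominated P N (localStep P f η N B) := fun s D _ => by
  set b := ⨆ θ, nStep P θ (N s.1) s.1 D
  have hrun (θ : Θ) : nStep P θ (N s.1) s.1 D ≤ b := le_iSup (fun θ => nStep P θ (N s.1) s.1 D) θ
  refine (Measure.bind_apply_le _ (measurableSet_preimage_fst D)).trans
    (lintegral_le_const (ae_of_all _ fun γ => ?_))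
  calc _ ≤ ∫⁻ x', ((nStep P γ (N s.1) s.1).bind fun y => metropolis η f (x', s.2) (y, γ))
          (Prod.fst ⁻¹' D) ∂(nStep P s.2 (N s.1) s.1) :=
        Measure.bind_apply_le _ (measurableSet_preimage_fst D)
    _ ≤ ∫⁻ x', (b + D.indicator 1 x') ∂(nStep P s.2 (N s.1) s.1) := lintegral_mono fun x' =>
        (bind_metropolis_preimage_fst_le hη _ (x', s.2) γ D).trans (by gcongr; exact hrun γ)
    _ = b + nStep P s.2 (N s.1) s.1 D := by
        rw [lintegral_add_left measurable_const, lintegral_indicator_one .of_discrete,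
          lintegral_const, measure_univ, mul_one]
    _ ≤ 2 * b := by rw [two_mul]; gcongr; exact hrun s.2

theorem isProbabilityMeasure_uniformParam {I : ℕ} {L : Set (Fin I → ℝ)} (hL : MeasurableSet L)
    (h₀ : volume L ≠ 0) (h₁ : volume L ≠ ∞) : IsProbabilityMeasure (uniformParam L) := by
  have := cond_isProbabilityMeasure_of_finite h₀ h₁
  refine (MeasurableEmbedding.subtype_coe hL).isProbabilityMeasure_comap ?_
  simpa using ae_cond_mem hL

end Search

section MarkovChain

variable {E X Ω : Type*} [MeasurableSpace E] [mΩ : MeasurableSpace Ω] {μ : Measure Ω}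
  {ℱ : Filtration ℕ mΩ} {Q : E → Measure E} {S : ℕ → Ω → E}
  [Countable X] [MeasurableSpace X] [MeasurableSingletonClass X] {g : E → X}

theorem IsMarkovChain.measure_mem_le (hS : IsMarkovChain μ ℱ Q S) (hg : Measurable g)
    {R : X → Set E} (hR : ∀ x, MeasurableSet (R x)) {b : ℝ≥0∞} (hb : ∀ s, Q s (R (g s)) ≤ b)
    (k : ℕ) : μ {ω | S (k + 1) ω ∈ R (g (S k ω))} ≤ b * μ Set.univ := by
  set F : X → Set Ω := fun x => (g ∘ S k) ⁻¹' {x}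
  have hF (x : X) : MeasurableSet[ℱ k] (F x) :=
    (hg.comp (hS.adapted k)) (measurableSet_singleton x)
  have hcover : ⋃ x, F x = Set.univ := by ext ω; simp [F]
  have hfibre (x : X) : μ (F x ∩ S (k + 1) ⁻¹' R x) ≤ b * μ (F x) := by
    rw [hS.transition k _ (hF x) _ (hR x), ← setLIntegral_const]
    refine setLIntegral_mono measurable_const fun ω hω => ?_
    obtain rfl : g (S k ω) = x := hω
    exact hb (S k ω)
  calc μ {ω | S (k + 1) ω ∈ R (g (S k ω))}
      ≤ μ (⋃ x, F x ∩ S (k + 1) ⁻¹' R x) :=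
        measure_mono fun ω hω => Set.mem_iUnion.2 ⟨g (S k ω), rfl, hω⟩
    _ ≤ ∑' x, b * μ (F x) := (measure_iUnion_le _).trans (ENNReal.tsum_le_tsum hfibre)
    _ = b * μ Set.univ := by
        rw [ENNReal.tsum_mul_left, ← hcover, measure_iUnion (fun x y hxy =>
          (Set.disjoint_singleton.2 hxy).preimage _) fun x => ℱ.le k _ (hF x)]

theorem IsMarkovChain.ae_notMem (hS : IsMarkovChain μ ℱ Q S) (hg : Measurable g)
    {R : X → Set E} (hR : ∀ x, MeasurableSet (R x)) (hQ : ∀ s, Q s (R (g s)) = 0) :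
    ∀ᵐ ω ∂μ, ∀ k, S (k + 1) ω ∉ R (g (S k ω)) :=
  ae_all_iff.2 fun k => measure_eq_zero_iff_ae_notMem.1 <| nonpos_iff_eq_zero.1 <|
    (hS.measure_mem_le hg hR (fun s => (hQ s).le) k).trans_eq (zero_mul _)

theorem summable_exp_neg_two_mul_log : Summable fun k : ℕ => Real.exp (-(2 * Real.log k)) := by
  refine (Real.summable_one_div_nat_pow.2 one_lt_two).congr_atTop ?_
  filter_upwards [eventually_gt_atTop 0] with k hk
  rw [Real.exp_neg, two_mul, Real.exp_add, Real.exp_log (Nat.cast_pos.2 hk), one_div, sq]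

theorem IsMarkovChain.ae_eventually_lt_log_or_le [IsFiniteMeasure μ]
    (hS : IsMarkovChain μ ℱ Q S) (hg : Measurable g) (f : X → ℝ) {C : ℝ≥0∞} (hC : C ≠ ∞) {β : ℝ}
    (hβ : 0 < β) (hQ : ∀ s, Q s {s' | f (g s) < f (g s')} ≤ C * ennexp (-(β * f (g s)))) :
    ∀ᵐ ω ∂μ, ∀ᶠ k : ℕ in atTop,
      f (g (S k ω)) < 2 / β * Real.log k ∨ f (g (S (k + 1) ω)) ≤ f (g (S k ω)) := by
  set R : ℕ → X → Set E := fun k x => {s | 2 / β * Real.log k ≤ f x ∧ f x < f (g s)}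
  have hR (k : ℕ) (x : X) : MeasurableSet (R k x) :=
    hg (Set.to_countable {y | 2 / β * Real.log k ≤ f x ∧ f x < f y}).measurableSet
  have hjump (k : ℕ) (s : E) : Q s (R k (g s)) ≤ C * ennexp (-(2 * Real.log k)) := by
    by_cases hs : 2 / β * Real.log k ≤ f (g s)
    · refine (measure_mono fun s' hs' => hs'.2).trans ((hQ s).trans ?_)
      rw [div_mul_eq_mul_div, div_le_iff₀' hβ] at hs
      gcongr
      exact ennexp_mono (neg_le_neg hs)
    · simp [R, hs]
  have hsum : ∑' k, μ {ω | S (k + 1) ω ∈ R k (g (S k ω))} ≠ ∞ := by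
    refine ne_top_of_le_ne_top ?_
      (ENNReal.tsum_le_tsum fun k => hS.measure_mem_le hg (hR k) (hjump k) k)
    rw [ENNReal.tsum_mul_right, ENNReal.tsum_mul_left]
    exact ENNReal.mul_ne_top (ENNReal.mul_ne_top hC summable_exp_neg_two_mul_log.tsum_ofReal_ne_top)
      (measure_ne_top μ _)
  filter_upwards [ae_eventually_notMem hsum] with ω hω
  filter_upwards [hω] with k hk
  by_contra! hrise
  exact hk hrise

end MarkovChain

section Growth

variable {u : ℕ → ℝ} {a b ρ : ℝ}

theorem exists_eventually_le_add_log (hb : ∀ k, u (k + 1) ≤ a * u k + b)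
    (ha : 0 ≤ a) (hρ : 0 ≤ ρ)
    (hrise : ∀ᶠ k : ℕ in atTop, u k < ρ * Real.log k ∨ u (k + 1) ≤ u k) :
    ∃ M, ∀ᶠ k : ℕ in atTop, u k ≤ M + a * ρ * Real.log k := by
  obtain ⟨K, hK⟩ := eventually_atTop.1 (hrise.and (eventually_gt_atTop 0))
  have hlog (k : ℕ) : 0 ≤ a * ρ * Real.log k :=
    mul_nonneg (mul_nonneg ha hρ) (Real.log_natCast_nonneg k)
  refine ⟨max (u K) b, eventually_atTop.2 ⟨K, fun k hk => ?_⟩⟩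
  induction k, hk using Nat.le_induction with
  | base => linarith [le_max_left (u K) b, hlog K]
  | succ k hk ih =>
    obtain ⟨hlow_or_fall, hk₀⟩ := hK k hk
    have hlog_succ : a * ρ * Real.log k ≤ a * ρ * Real.log (k + 1 : ℕ) := by
      gcongr
      exact k.le_succ
    rcases hlow_or_fall with hlow | hfall
    · linarith [hb k, mul_le_mul_of_nonneg_left hlow.le ha, le_max_right (u K) b]
    · exact hfall.trans (ih.trans (by linarith))

theorem tendsto_div_natCast_of_eventually_lt_log_or_le (hu : ∀ k, 0 ≤ u k)
    (hb : ∀ k, u (k + 1) ≤ a * u k + b) (ha : 0 ≤ a) (hρ : 0 ≤ ρ)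
    (hrise : ∀ᶠ k : ℕ in atTop, u k < ρ * Real.log k ∨ u (k + 1) ≤ u k) :
    Tendsto (fun k : ℕ => u k / k) atTop (𝓝 0) := by
  obtain ⟨M, hM⟩ := exists_eventually_le_add_log hb ha hρ hrise
  have hlog : Tendsto (fun k : ℕ => Real.log k / k) atTop (𝓝 0) :=
    Real.isLittleO_log_id_atTop.tendsto_div_nhds_zero.comp tendsto_natCast_atTop_atTop
  have hlim : Tendsto (fun k : ℕ => M / k + a * ρ * (Real.log k / k)) atTop (𝓝 0) := by
    simpa using (tendsto_const_div_atTop_nhds_zero_nat M).add (hlog.const_mul (a * ρ))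
  refine squeeze_zero' (.of_forall fun k => div_nonneg (hu k) k.cast_nonneg) ?_ hlim
  filter_upwards [hM] with k hk
  rw [← mul_div_assoc, ← add_div]
  gcongr

theorem mul_le_totalTime {J : ℕ} {τ : State J → ℝ} {d : ℝ} (hτ : ∀ x, d ≤ τ x)
    (y : ℕ → State J) (k : ℕ) : k * d ≤ totalTime τ y k := by
  simpa [totalTime] using
    Finset.card_nsmul_le_sum (Finset.range k) (fun i => τ (y i)) d fun i _ => hτ (y i)

theorem tendsto_div_totalTime_of_tendsto_div {J : ℕ} {τ : State J → ℝ} {d : ℝ} (hd : 0 < d)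
    (hτ : ∀ x, d ≤ τ x) (y : ℕ → State J) (hlim : Tendsto (fun k : ℕ => u k / k) atTop (𝓝 0)) :
    Tendsto (fun k => u k / totalTime τ y k) atTop (𝓝 0) := by
  refine squeeze_zero_norm' ?_ (by simpa using hlim.norm.div_const d)
  filter_upwards [eventually_gt_atTop 0] with k hk
  have hkd : 0 < k * d := by positivity
  have htime := mul_le_totalTime hτ y k
  rw [norm_div, Real.norm_of_nonneg (hkd.le.trans htime), Real.norm_eq_abs, div_div]
  gcongr

end Growth

section Convergence

variable {J : ℕ} {Θ Ω : Type*} [MeasurableSpace Θ] [mΩ : MeasurableSpace Ω]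
  {P : Kernel (Θ × State J) (State J)} [IsMarkovKernel P] {f : State J → ℝ} {N : State J → ℕ}
  {μ : Measure Ω} [IsFiniteMeasure μ] {ℱ : Filtration ℕ mΩ}
  {Q : State J × Θ → Measure (State J × Θ)} {S : ℕ → Ω → State J × Θ}

theorem IsMarkovChain.ae_tendsto_div_totalTime (hS : IsMarkovChain μ ℱ Q S)
    (hQ : RunDominated P N Q) (hf : ∀ x, 0 ≤ f x) (hinc : BoundedIncrements P f)
    (hstable : IsFStable P f) {c d : ℝ} (hc : 0 < c) (hd : 0 < d)
    (hN : ∀ x, |(N x : ℝ) - (c * f x + d)| < 1) :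
    ∀ᵐ ω ∂μ, Tendsto
      (fun k => f (S k ω).1 / totalTime (fun x => c * f x + d) (fun i => (S i ω).1) k)
      atTop (𝓝 0) := by
  obtain ⟨β, hβ, C, hC, hrun⟩ := exists_nStep_lt_le_ennexp hf hinc hstable hc (r := 1)
    fun x => by linarith [(abs_lt.1 (hN x)).1]
  obtain ⟨φ, hφ₀, hφ⟩ := hinc
  have hrise := hS.ae_eventually_lt_log_or_le measurable_fst f (ENNReal.mul_ne_top (by simp) hC)
    hβ (hQ.preimage_lt_le hrun)
  have haffine := hS.ae_notMem measurable_fst (fun x => measurableSet_preimage_fst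
    {y | (1 + c * φ) * f x + (d + 1) * φ < f y}) (hQ.preimage_affine_lt_eq_zero hf hφ₀.le hφ hc.le
      (by positivity) fun x => by linarith [(abs_lt.1 (hN x)).2])
  filter_upwards [hrise, haffine] with ω hriseω haffineω
  exact tendsto_div_totalTime_of_tendsto_div hd
    (fun x => le_add_of_nonneg_left (mul_nonneg hc.le (hf x))) _
    (tendsto_div_natCast_of_eventually_lt_log_or_le (fun k => hf (S k ω).1)
      (fun k => not_lt.1 (haffineω k)) (by positivity) (by positivity) hriseω)

end Convergence

end StabilitySearch

open StabilitySearch in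
theorem theorem1_general {J : ℕ} {Θ : Type*} [MeasurableSpace Θ] [MeasurableSingletonClass Θ]
    (P : Kernel (Θ × State J) (State J)) [IsMarkovKernel P] (f : State J → ℝ) (hf : ∀ x, 0 ≤ f x)
    (hinc : BoundedIncrements P f) (hstable : IsFStable P f) (η c d : ℝ) (hη : 0 ≤ η) (hc : 0 < c)
    (hd : 0 < d) (N : State J → ℕ) (hN : ∀ x, |(N x : ℝ) - (c * f x + d)| < 1)
    {Ω : Type*} [mΩ : MeasurableSpace Ω] (μ : Measure Ω) [IsFiniteMeasure μ]
    (ℱ : Filtration ℕ mΩ) (S : ℕ → Ω → State J × Θ) :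
    (∀ U : Measure Θ, IsProbabilityMeasure U → IsMarkovChain μ ℱ (globalStep P f η N U) S →
        ∀ᵐ ω ∂μ, Tendsto
          (fun k => f (S k ω).1 / totalTime (fun x => c * f x + d) (fun i => (S i ω).1) k)
          atTop (𝓝 0)) ∧
      (∀ B : Θ → Set Θ, (∀ l, (B l).Finite) → (∀ l, (B l).Nonempty) →
        IsMarkovChain μ ℱ (localStep P f η N B) S →
        ∀ᵐ ω ∂μ, Tendsto
          (fun k => f (S k ω).1 / totalTime (fun x => c * f x + d) (fun i => (S i ω).1) k)
          atTop (𝓝 0)) := by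
  refine ⟨fun U _ hS => ?_, fun B hfin hne hS => ?_⟩
  · exact hS.ae_tendsto_div_totalTime (runDominated_globalStep hη U) hf hinc hstable hc hd hN
  · have (l : Θ) := isProbabilityMeasure_uniformOn (hfin l) (hne l)
    exact hS.ae_tendsto_div_totalTime (runDominated_localStep hη B) hf hinc hstable hc hd hN

theorem theorem1 {I J : ℕ}
    -- parameter set and family of Markov chains
    (L : Set (Fin I → ℝ)) (P : Kernel (L × StabilitySearch.State J) (StabilitySearch.State J))
    [IsMarkovKernel P]
    -- Lyapunov function
    (f : StabilitySearch.State J → ℝ) (hf : ∀ x, 0 ≤ f x)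
    (hinc : StabilitySearch.BoundedIncrements P f)
    (hstable : StabilitySearch.IsFStable P f)
    -- user's choices: `τ(x) = c f(x) + d`, rounded to the number `N(x)` of simulated steps
    (η c d : ℝ) (hη : 0 < η) (hc : 0 < c) (hd : 0 < d)
    (N : StabilitySearch.State J → ℕ) (hN : ∀ x, |(N x : ℝ) - (c * f x + d)| < 1)
    -- the process `S k = (Y_k, Λ_k)`
    {Ω : Type*} [mΩ : MeasurableSpace Ω] (μ : Measure Ω) [IsProbabilityMeasure μ]
    (ℱ : Filtration ℕ mΩ) (S : ℕ → Ω → StabilitySearch.State J × L) :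
    -- global search
    ((MeasurableSet L → volume L ≠ 0 → volume L ≠ ∞ →
        StabilitySearch.IsMarkovChain μ ℱ
          (StabilitySearch.globalStep P f η N (StabilitySearch.uniformParam L)) S →
        ∀ᵐ ω ∂μ, Tendsto
          (fun k => f (S k ω).1 /
            StabilitySearch.totalTime (fun x => c * f x + d) (fun i => (S i ω).1) k)
          atTop (𝓝 0)) ∧
    -- local search
      (L.Finite → ∀ B : L → Set L, (∀ l, l ∈ B l) →
        StabilitySearch.IsMarkovChain μ ℱ (StabilitySearch.localStep P f η N B) S →
        ∀ᵐ ω ∂μ, Tendsto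
          (fun k => f (S k ω).1 /
            StabilitySearch.totalTime (fun x => c * f x + d) (fun i => (S i ω).1) k)
          atTop (𝓝 0))) := by
  have general := theorem1_general P f hf hinc hstable η c d hη.le hc hd N hN μ ℱ S
  exact ⟨fun hL h₀ h₁ => general.1 _ (StabilitySearch.isProbabilityMeasure_uniformParam hL h₀ h₁),
    fun hfin B hB => general.2 B (fun l => have := hfin.to_subtype; (B l).toFinite)
      fun l => ⟨l, hB l⟩⟩
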